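/- Let $\mathcal S$ be a complete separable metric space with a Borel reference measure $|\cdot|$ (written $\mathrm du$ in integrals) that is non-atomic, $\sigma$-finite and finite on bounded sets. All sets are Borel. Let $\mathbf N$ be the space of locally finite point configurations $\mathbf x\subseteq\mathcal S$ (finitely many points in each bounded set), with the $\sigma$-algebra generated by the counts $\mathbf x\mapsto\#(\mathbf x\cap B)$, $B$ bounded. Let $\{\lambda_\theta\}_{\theta\in\Theta}$ and $\{h_\theta\}_{\theta\in\Theta}$ be families of measurable functions $\lambda_\theta:\mathcal S\times\mathbf N\to[0,\infty)$ and $h_\theta:\mathcal S\times\mathbf N\to\mathbb R$, and let $X$ be a point process in $\mathcal S$, i.e. a random element of $\mathbf N$, whose Papangelou conditional intensity is $\lambda_{\theta_0}$ for some $\theta_0\in\Theta$: $$\mathbb E\Big[\sum_{u\in X} g(u,X\setminus\{u\})\Big]=\int_{\mathcal S}\mathbb E[g(u,X)\lambda_{\theta_0}(u|X)]\,\mathrm du\qquad\text{for all measurable } g\ge 0 .$$ For a function $\xi$ on $\mathcal S\times\mathbf N$, configurations $\mathbf y,\mathbf z$ and a bounded set $A$, define the prediction error $$\mathcal I_{\xi}^{h_\theta}(A;\mathbf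 z,\mathbf y)=\sum_{x\in\mathbf z\cap A}h_\theta(x;\mathbf y\setminus\{x\})-\int_A h_\theta(u;\mathbf y)\,\xi(u;\mathbf y)\,\mathrm du .$$ Assume that, for every $\theta\in\Theta$, the functions $(u,\mathbf x)\mapsto\lambda_\theta(u|\mathbf x)$ and $(u,\mathbf x)\mapsto h_\theta(u;\mathbf x)$ are bounded. Let $A\subseteq\mathcal S$ be bounded and, for $k\ge2$, let $\{A_{ik}\}_{i=1}^k$ be a partition of $A$ such that $\max_{i\le k}|A_{ik}|\to0$ as $k\to\infty$ and such that the partitions are refining: every $A_{j(k+1)}$, $j=1,\dots,k+1$, is contained in some $A_{ik}$. Consider the block cross-validation of $X\cap A$ with retention probabilities $p_{ik}(u)=\mathbf 1\{u\in A_{ik}\}$, i.e. $$X_{ik}^V=X\cap A_{ik},\qquad X_{ik}^T=(X\cap A)\setminus X_{ik}^V,\qquad i=1,\dots,k,$$ and let $$\xi_\theta(u;X_{ik}^T)=V_{\theta,ik}(u)\,\lambda_\theta(u|X_{ik}^T),\qquad V_{\theta,ik}(u)=p_{ik}(u)\,\mathbb E\Big[\frac{\lambda_\theta(u|X_{ik}^T\cup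 X_{ik}^V)}{\lambda_\theta(u|X_{ik}^T)}\,\Big|\,X_{ik}^T\Big],$$ where $0/0=0$, $0\cdot\infty=0$, the conditional expectation is that of a $[0,\infty]$-valued random variable, and $V_{\theta,ik}(u)=V_{\theta,ik}(u,X_{ik}^T)$ denotes any version that is jointly measurable in $u$ and the configuration $X_{ik}^T$. Then such versions of $V_{\theta,ik}$ exist for all $\theta\in\Theta$, $k\ge2$ and $i\le k$, and for any choice of them the integrals in the prediction errors below exist almost surely and, for every $\theta\in\Theta$, $$\sum_{i=1}^k\mathcal I_{\xi_\theta}^{h_\theta}(A;X_{ik}^V,X_{ik}^T)-\mathcal I_{\lambda_\theta}^{h_\theta}(A;X\cap A,X\cap A)\longrightarrow0\quad\text{in probability as }k\to\infty .$$ -/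

import Mathlib

open MeasureTheory Filter Topology
open scoped ENNReal NNReal

/-- A point configuration of a metric space: a set with finitely many points in every bounded set. -/
structure Config (S : Type*) [MetricSpace S] where
  /-- the set of points -/
  pts : Set S
  /-- local finiteness -/
  finite_inter' : ∀ B : Set S, Bornology.IsBounded B → (pts ∩ B).Finite

namespace Config

variable {S : Type*} [MetricSpace S]

/-- The `σ`-algebra on configurations generated by the counts `x ↦ #(x ∩ B)`, `B` bounded Borel.
It is the Borel `σ`-algebra of the usual Prohorov-type metrics on configurations. -/
noncomputable instance instMeasurableSpace [MeasurableSpace S] : MeasurableSpace (Config S) :=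
  ⨆ (B : Set S) (_ : MeasurableSet B) (_ : Bornology.IsBounded B),
    MeasurableSpace.comap (fun x : Config S => (x.pts ∩ B).ncard) ⊤

/-- The part `x ∩ B` of a configuration in a set `B`. -/
def restrict (x : Config S) (B : Set S) : Config S where
  pts := x.pts ∩ B
  finite_inter' D hD :=
    (x.finite_inter' D hD).subset (Set.inter_subset_inter_left D Set.inter_subset_left)

/-- The difference `x \ y` of two configurations. -/
def diff (x y : Config S) : Config S where
  pts := x.pts \ y.pts
  finite_inter' D hD :=
    (x.finite_inter' D hD).subset (Set.inter_subset_inter_left D Set.sdiff_subset)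

/-- The superposition `x ∪ y` of two configurations. -/
def union (x y : Config S) : Config S where
  pts := x.pts ∪ y.pts
  finite_inter' D hD := by
    rw [Set.union_inter_distrib_right]
    exact (x.finite_inter' D hD).union (y.finite_inter' D hD)

/-- The configuration `x \ {u}`. -/
def erase (x : Config S) (u : S) : Config S where
  pts := x.pts \ {u}
  finite_inter' D hD :=
    (x.finite_inter' D hD).subset (Set.inter_subset_inter_left D Set.sdiff_subset)

end Config

section

variable {S : Type*} [MetricSpace S] [MeasurableSpace S]
variable {Ω : Type*} [MeasurableSpace Ω]

/-- `lam` is a (Papangelou) conditional intensity of the point process `X` with respect to the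
reference measure `μ`: it is measurable and satisfies the Georgii-Nguyen-Zessin formula
`E ∑_{u ∈ X} g(u, X \ {u}) = ∫ E[g(u, X) lam(u | X)] du` for all measurable `g ≥ 0`. -/
def IsConditionalIntensity (μ : Measure S) (P : Measure Ω) (X : Ω → Config S)
    (lam : S → Config S → ℝ≥0) : Prop :=
  Measurable (Function.uncurry lam) ∧
  ∀ g : S → Config S → ℝ≥0∞, Measurable (Function.uncurry g) →
    ∫⁻ ω, ∑' u : (X ω).pts, g u ((X ω).erase u) ∂P =
      ∫⁻ u, ∫⁻ ω, g u (X ω) * lam u (X ω) ∂P ∂μ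

/-- The `h`-weighted prediction error
`∑_{x ∈ z ∩ A} h(x; y \ {x}) - ∫_A h(u; y) ξ(u; y) du` (for bounded `A` the sum is finite). -/
noncomputable def predictionError (μ : Measure S) (h ξ : S → Config S → ℝ) (A : Set S)
    (z y : Config S) : ℝ :=
  (∑ᶠ x ∈ z.pts ∩ A, h x (y.erase x)) - ∫ u in A, h u y * ξ u y ∂μ

/-- `c` is a (Borel) partition of `A` into `k` cells. -/
structure IsCellPartition (A : Set S) {k : ℕ} (c : Fin k → Set S) : Prop where
  measurable : ∀ i, MeasurableSet (c i)
  disjoint : Pairwise (Function.onFun Disjoint c)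
  iUnion_eq : ⋃ i, c i = A

/-- The retention probability `p(u) = 1{u ∈ B}` of a fold of block cross-validation. -/
noncomputable def blockRetention (B : Set S) (u : S) : ℝ≥0∞ := B.indicator (fun _ => 1) u

/-- Validation set of the fold with cell `B`: the thinning of `x` with retention probability
`1{u ∈ B}`, that is, exactly the points of `x` in `B` are retained. -/
def blockValidation (x : Config S) (B : Set S) : Config S := x.restrict B

/-- Training set of the fold with cell `B`: the points of `x` which are not in the validation set. -/
def blockTraining (x : Config S) (B : Set S) : Config S := x.diff (blockValidation x B)

/-- `V` is (a jointly measurable version of) the weight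
`V(u) = p(u) E[lam(u | XT ∪ XV) / lam(u | XT) | XT]`, written as a function of `u` and of the value
of `XT`. The division is that of `[0, ∞]`, so `0 / 0 = 0`; the conditional expectation is that of a
`[0, ∞]`-valued random variable given the `σ`-algebra generated by `XT`. -/
def IsPPLWeight (μ : Measure S) (P : Measure Ω) (lam : S → Config S → ℝ≥0) (p : S → ℝ≥0∞)
    (XT XV : Ω → Config S) (V : S → Config S → ℝ≥0∞) : Prop :=
  Measurable (Function.uncurry V) ∧
  ∀ᵐ u ∂μ, ∀ᵐ ω ∂P, V u (XT ω) = p u *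
    condLExp (MeasurableSpace.comap XT inferInstance) P
      (fun ω' => (lam u ((XT ω').union (XV ω')) : ℝ≥0∞) / (lam u (XT ω') : ℝ≥0∞)) ω

/-- The estimator `ξ(u; y) = V(u) lam(u | y)` with weight `V`. -/
noncomputable def weightedEstimator (lam : S → Config S → ℝ≥0) (V : S → Config S → ℝ≥0∞)
    (u : S) (y : Config S) : ℝ :=
  (V u y * lam u y).toReal

end

/-! Let `C₀` bound the conditional intensity of `X`. Testing the Georgii-Nguyen-Zessin formula on
indicators shows that a cell `B` is hit with probability at most `C₀|B|` and has two points with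
probability at most `(C₀|B|)²`. Up to probability `C₀² ∑ |A_ik|²`, every cell therefore has at most
one point. A point `x` alone in its cell sees the same configuration `(X ∩ A) \ {x}` in its fold as
in the whole, so the point sums agree exactly and only integrals remain
(`enorm_sum_predictionError_sub_le`).

The weight vanishes off its cell, so each fold integral lives on one cell. There, with training set
`T`, pulling out `λ(u|T)` makes the estimator the conditional expectation of a variable that is
bounded and equals `λ(u|T)` when the cell is empty. It is thus within `C · P(cell hit | T)` of
`λ(u|T)` (`condLExp_div_mul_bounds`), and `T = X ∩ A` when the cell is empty. The expected error on
a cell is at most `3HCC₀|A_ik|²` (`IsPPLWeight.lintegral_error_le`), where `H` bounds `|h|`. Since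
`∑ |A_ik|² ≤ max |A_ik| · |A| → 0`, Markov's inequality concludes. -/

namespace Config

variable {S : Type*} [MetricSpace S]

theorem eq_of_pts_eq {x y : Config S} (h : x.pts = y.pts) : x = y := by
  cases x; cases y; cases h; rfl

theorem measurable_ncard [MeasurableSpace S] {B : Set S} (hB : MeasurableSet B)
    (hb : Bornology.IsBounded B) : Measurable fun x : Config S => (x.pts ∩ B).ncard := by
  rw [measurable_iff_comap_le]
  exact le_iSup_of_le B (le_iSup_of_le hB (le_iSup_of_le hb le_rfl))

theorem measurable_of_ncard [MeasurableSpace S] {Ω : Type*} [MeasurableSpace Ω] {X : Ω → Config S}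
    (h : ∀ B : Set S, MeasurableSet B → Bornology.IsBounded B →
      Measurable fun ω => ((X ω).pts ∩ B).ncard) : Measurable X := by
  rw [measurable_iff_comap_le, instMeasurableSpace]
  simp only [MeasurableSpace.comap_iSup, MeasurableSpace.comap_comp]
  refine iSup_le fun B => iSup_le fun hB => iSup_le fun hb => ?_
  exact (h B hB hb).comap_le

theorem measurable_restrict [MeasurableSpace S] {A : Set S} (hA : MeasurableSet A) :
    Measurable fun x : Config S => x.restrict A := by
  refine measurable_of_ncard fun B hB hb => ?_
  have : (fun x : Config S => ((x.restrict A).pts ∩ B).ncard) =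
      fun x => (x.pts ∩ (A ∩ B)).ncard := by
    funext x; simp only [restrict, Set.inter_assoc]
  rw [this]
  exact measurable_ncard (hA.inter hB) (hb.subset Set.inter_subset_right)

end Config

/-! ### Combinatorics of training and validation sets -/

section

variable {S : Type*} [MetricSpace S]

/-- Replaces a difference of random configurations by a restriction to a fixed Borel set, which is
visibly measurable. -/
theorem blockTraining_restrict (x : Config S) (A B : Set S) :
    blockTraining (x.restrict A) B = x.restrict (A \ B) := by
  apply Config.eq_of_pts_eq
  ext u
  simp only [blockTraining, blockValidation, Config.restrict, Config.diff, Set.mem_sdiff,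
    Set.mem_inter_iff]
  tauto

theorem blockTraining_union_blockValidation (x : Config S) (B : Set S) :
    (blockTraining x B).union (blockValidation x B) = x := by
  apply Config.eq_of_pts_eq
  ext u
  simp only [blockTraining, blockValidation, Config.restrict, Config.diff, Config.union,
    Set.mem_sdiff, Set.mem_inter_iff, Set.mem_union]
  tauto

/-- The training configuration differs from the whole one only if the cell is hit. -/
theorem blockTraining_eq_of_ncard_eq_zero (x : Config S) {A B : Set S} (hb : Bornology.IsBounded B)
    (h : (x.pts ∩ B).ncard = 0) : blockTraining (x.restrict A) B = x.restrict A := by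
  rw [Set.ncard_eq_zero (x.finite_inter' B hb)] at h
  rw [blockTraining_restrict]
  apply Config.eq_of_pts_eq
  ext u
  have : u ∉ x.pts ∩ B := by simp [h]
  simp only [Config.restrict, Set.mem_inter_iff, Set.mem_sdiff] at this ⊢
  tauto

/-- The training configuration of the cell of `u` is the whole configuration without `u` if the
cell has no other point. -/
theorem blockTraining_erase_eq_of_ncard_lt_two (x : Config S) {A B : Set S} (hb : Bornology.IsBounded B)
    (h : (x.pts ∩ B).ncard < 2) {u : S} (hu : u ∈ x.pts ∩ B) :
    (blockTraining (x.restrict A) B).erase u = (x.restrict A).erase u := by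
  rw [blockTraining_restrict]
  apply Config.eq_of_pts_eq
  ext v
  have : v ∈ x.pts ∩ B → v = u := fun hv =>
    (Set.ncard_le_one_iff (x.finite_inter' B hb)).1 (Nat.lt_succ_iff.1 h) hv hu
  simp only [Config.erase, Config.restrict, Set.mem_inter_iff, Set.mem_sdiff,
    Set.mem_singleton_iff] at this ⊢
  tauto

/-! ### Occupation probabilities of a small cell -/

variable [MeasurableSpace S] {Ω : Type*} [MeasurableSpace Ω] {μ : Measure S} {P : Measure Ω}
  {X : Ω → Config S} {lam : S → Config S → ℝ≥0} {C : ℝ≥0}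

/-- A point process with conditional intensity at most `C` hits `B` with probability at most
`C * μ B`. -/
theorem IsConditionalIntensity.measure_ncard_ne_zero_le [IsProbabilityMeasure P]
    (hX : IsConditionalIntensity μ P X lam) (hXm : Measurable X) (hC : ∀ u x, lam u x ≤ C)
    {B : Set S} (hB : MeasurableSet B) (hb : Bornology.IsBounded B) :
    P {ω | ((X ω).pts ∩ B).ncard ≠ 0} ≤ C * μ B := by
  have hN : MeasurableSet {ω | ((X ω).pts ∩ B).ncard ≠ 0} :=
    ((Config.measurable_ncard hB hb).comp hXm) (measurableSet_singleton 0).compl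
  -- The left side is the expected number of points in `B`, which dominates the probability of a
  -- hit.
  have hg := hX.2 (fun u _ => B.indicator 1 u)
    ((measurable_one.indicator hB).comp measurable_fst)
  calc P {ω | ((X ω).pts ∩ B).ncard ≠ 0}
      = ∫⁻ ω, {ω | ((X ω).pts ∩ B).ncard ≠ 0}.indicator 1 ω ∂P := (lintegral_indicator_one hN).symm
    _ ≤ ∫⁻ ω, ∑' u : (X ω).pts, B.indicator 1 (u : S) ∂P := by
        refine lintegral_mono fun ω => ?_
        by_cases hω : ω ∈ {ω | ((X ω).pts ∩ B).ncard ≠ 0}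
        swap
        · rw [Set.indicator_of_notMem hω]; exact zero_le
        rw [Set.indicator_of_mem hω]
        obtain ⟨u, hu⟩ := Set.nonempty_of_ncard_ne_zero hω
        refine le_trans ?_ (ENNReal.le_tsum (⟨u, hu.1⟩ : (X ω).pts))
        simp [hu.2]
    _ = ∫⁻ u, ∫⁻ ω, B.indicator 1 u * lam u (X ω) ∂P ∂μ := hg
    _ ≤ ∫⁻ u, B.indicator 1 u * C ∂μ := by
        refine lintegral_mono fun u => ?_
        calc _ ≤ ∫⁻ _, B.indicator 1 u * (C : ℝ≥0∞) ∂P :=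
              lintegral_mono fun ω => by gcongr; exact hC _ _
          _ = _ := by simp
    _ = C * μ B := by
        rw [lintegral_mul_const' _ _ ENNReal.coe_ne_top, lintegral_indicator_one hB, mul_comm]

/-- A point process with conditional intensity at most `C` has two points in `B` with probability
at most `(C * μ B) ^ 2`. -/
theorem IsConditionalIntensity.measure_two_le_ncard_le [IsProbabilityMeasure P]
    (hX : IsConditionalIntensity μ P X lam) (hXm : Measurable X) (hC : ∀ u x, lam u x ≤ C)
    {B : Set S} (hB : MeasurableSet B) (hb : Bornology.IsBounded B) :
    P {ω | 2 ≤ ((X ω).pts ∩ B).ncard} ≤ (C * μ B) ^ 2 := by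
  have hN : MeasurableSet {ω | 2 ≤ ((X ω).pts ∩ B).ncard} :=
    ((Config.measurable_ncard hB hb).comp hXm) (measurableSet_Ici (a := 2))
  have hM : MeasurableSet {x : Config S | (x.pts ∩ B).ncard ≠ 0} :=
    (Config.measurable_ncard hB hb) (measurableSet_singleton 0).compl
  -- The second factor asks for another point in `B` after `u` is erased. On the right side it is
  -- evaluated at `X` itself, so the hitting bound applies again and supplies the second factor `C *
  -- μ B`.
  have hg := hX.2 (fun u x => B.indicator 1 u * {x : Config S | (x.pts ∩ B).ncard ≠ 0}.indicator 1 x)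
    (((measurable_one.indicator hB).comp measurable_fst).mul
      ((measurable_one.indicator hM).comp measurable_snd))
  calc P {ω | 2 ≤ ((X ω).pts ∩ B).ncard}
      = ∫⁻ ω, {ω | 2 ≤ ((X ω).pts ∩ B).ncard}.indicator 1 ω ∂P := (lintegral_indicator_one hN).symm
    _ ≤ ∫⁻ ω, ∑' u : (X ω).pts, B.indicator 1 (u : S) *
          {x : Config S | (x.pts ∩ B).ncard ≠ 0}.indicator 1 ((X ω).erase u) ∂P := by
        refine lintegral_mono fun ω => ?_
        by_cases hω : ω ∈ {ω | 2 ≤ ((X ω).pts ∩ B).ncard}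
        swap
        · rw [Set.indicator_of_notMem hω]; exact zero_le
        rw [Set.indicator_of_mem hω]
        have hfin := (X ω).finite_inter' B hb
        obtain ⟨u, v, hu, hv, huv⟩ :=
          (Set.one_lt_ncard_iff hfin).1 (lt_of_lt_of_le one_lt_two hω)
        refine le_trans ?_ (ENNReal.le_tsum (⟨u, hu.1⟩ : (X ω).pts))
        have : (X ω).erase u ∈ {x : Config S | (x.pts ∩ B).ncard ≠ 0} :=
          Set.ncard_ne_zero_of_mem (a := v) ⟨⟨hv.1, huv.symm⟩, hv.2⟩
            (((X ω).erase u).finite_inter' B hb)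
        rw [Set.indicator_of_mem hu.2, Set.indicator_of_mem this]
        simp
    _ = ∫⁻ u, ∫⁻ ω, B.indicator 1 u *
          {x : Config S | (x.pts ∩ B).ncard ≠ 0}.indicator 1 (X ω) * lam u (X ω) ∂P ∂μ := hg
    _ ≤ ∫⁻ u, B.indicator 1 u * (P {ω | ((X ω).pts ∩ B).ncard ≠ 0} * C) ∂μ := by
        refine lintegral_mono fun u => ?_
        calc _ ≤ ∫⁻ ω, B.indicator 1 u *
                (X ⁻¹' {x : Config S | (x.pts ∩ B).ncard ≠ 0}).indicator 1 ω * (C : ℝ≥0∞) ∂P :=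
              lintegral_mono fun ω => by
                gcongr
                · exact le_rfl
                · exact hC _ _
          _ = B.indicator 1 u * (P {ω | ((X ω).pts ∩ B).ncard ≠ 0} * C) := by
                simp_rw [mul_assoc]
                rw [lintegral_const_mul _ (((measurable_one.indicator (hXm hM))).mul_const _),
                  lintegral_mul_const' _ _ ENNReal.coe_ne_top, lintegral_indicator_one (hXm hM)]
                rfl
    _ ≤ ∫⁻ u, B.indicator 1 u * (C * μ B * C) ∂μ := by
        gcongr with u
        exact hX.measure_ncard_ne_zero_le hXm hC hB hb
    _ = (C * μ B) ^ 2 := by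
        rw [lintegral_mul_const _ (measurable_one.indicator hB), lintegral_indicator_one hB]
        ring

end

/-! ### Conditional expectations of `[0, ∞]`-valued variables -/

section

variable {Ω : Type*} {m m₀ : MeasurableSpace Ω} {P : Measure[m₀] Ω}

/-- Pull-out property of the conditional Lebesgue expectation. -/
theorem condLExp_mul_right (hm : m ≤ m₀) [SigmaFinite (P.trim hm)] {Y Z : Ω → ℝ≥0∞}
    (hY : Measurable[m₀] Y) (hZ : Measurable[m] Z) :
    condLExp m P (fun ω => Y ω * Z ω) =ᵐ[P] fun ω => condLExp m P Y ω * Z ω := by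
  refine (ae_eq_condLExp hm P _ ((measurable_condLExp m P Y).mul hZ) fun s hs => ?_).symm
  -- The densities `Y` and `E[Y | m]` define the same measure on `m`, so every `m`-measurable
  -- function has the same integral against both.
  have key : (P.withDensity (condLExp m P Y)).trim hm = (P.withDensity Y).trim hm := by
    refine @Measure.ext _ m _ _ fun t ht => ?_
    rw [trim_measurableSet_eq hm ht, trim_measurableSet_eq hm ht, withDensity_apply _ (hm t ht),
      withDensity_apply _ (hm t ht), setLIntegral_condLExp hm P Y ht]
  have h (W : Ω → ℝ≥0∞) (hW : Measurable[m₀] W) :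
      ∫⁻ ω in s, W ω * Z ω ∂P = ∫⁻ ω, s.indicator Z ω ∂(P.withDensity W).trim hm := by
    rw [lintegral_trim hm (hZ.indicator hs),
      lintegral_withDensity_eq_lintegral_mul _ hW ((hZ.indicator hs).mono hm le_rfl),
      ← lintegral_indicator (hm s hs)]
    refine lintegral_congr fun ω => ?_
    by_cases hω : ω ∈ s <;> simp [hω]
  refine (h _ (measurable_condLExp' m P Y)).trans ?_
  rw [h _ hY, key]

end

section

variable {S T Ω : Type*} [MeasurableSpace S] [MeasurableSpace T] [MeasurableSpace Ω]

/-- The conditional expectations given `Y` of a measurable family of `[0, ∞]`-valued random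
variables have a version which is jointly measurable in the parameter and in the value of `Y`. -/
theorem exists_measurable_condLExp_comap (P : Measure Ω) [IsFiniteMeasure P] {Y : Ω → T}
    (hY : Measurable Y) {f : S × Ω → ℝ≥0∞} (hf : Measurable f) :
    ∃ G : S × T → ℝ≥0∞, Measurable G ∧ ∀ u, (fun ω => G (u, Y ω)) =ᵐ[P]
      condLExp (MeasurableSpace.comap Y inferInstance) P (fun ω => f (u, ω)) := by
  have hm : MeasurableSpace.comap Y inferInstance ≤ (inferInstance : MeasurableSpace Ω) :=
    hY.comap_le
  have hset : ∀ E : Set (S × Ω), MeasurableSet E → ∃ G : S × T → ℝ≥0∞, Measurable G ∧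
      ∀ u, (fun ω => G (u, Y ω)) =ᵐ[P]
        condLExp (MeasurableSpace.comap Y inferInstance) P (fun ω => E.indicator 1 (u, ω)) := by
    -- Dynkin's π-λ argument: on a rectangle `B ×ˢ D` the version is `1_B` times a factorization of
    -- `E[1_D | Y]` through `Y`.
    refine MeasurableSpace.induction_on_inter generateFrom_prod.symm isPiSystem_prod ?_ ?_ ?_ ?_
    · refine ⟨0, measurable_zero, fun u => ?_⟩
      have : (fun ω => (∅ : Set (S × Ω)).indicator (1 : S × Ω → ℝ≥0∞) (u, ω)) = 0 := by
        funext ω; simp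
      rw [this, condLExp_zero]
      rfl
    · rintro _ ⟨B, hB, D, hD, rfl⟩
      obtain ⟨G, hG, hGe⟩ := (measurable_condLExp (MeasurableSpace.comap Y inferInstance) P
        (D.indicator 1)).exists_eq_measurable_comp
      refine ⟨fun z => B.indicator 1 z.1 * G z.2,
        ((measurable_one.indicator hB).comp measurable_fst).mul (hG.comp measurable_snd),
        fun u => ?_⟩
      by_cases hu : u ∈ B
      · have : (fun ω => (B ×ˢ D).indicator (1 : S × Ω → ℝ≥0∞) (u, ω)) = D.indicator 1 := by
          funext ω; by_cases hω : ω ∈ D <;> simp [hu, hω]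
        rw [this, hGe]
        exact ae_of_all _ fun ω => by simp [hu]
      · have : (fun ω => (B ×ˢ D).indicator (1 : S × Ω → ℝ≥0∞) (u, ω)) = 0 := by
          funext ω; simp [hu]
        rw [this, condLExp_zero]
        exact ae_of_all _ fun ω => by simp [hu]
    · rintro E hE ⟨G, hG, hGe⟩
      refine ⟨fun z => 1 - G z, measurable_const.sub hG, fun u => ?_⟩
      have hEu : Measurable fun ω => E.indicator (1 : S × Ω → ℝ≥0∞) (u, ω) :=
        (measurable_one.indicator hE).comp measurable_prodMk_left
      have hadd := condLExp_add_left (mΩ := MeasurableSpace.comap Y inferInstance)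
        (fun ω => Eᶜ.indicator (1 : S × Ω → ℝ≥0∞) (u, ω)) (hEu.aemeasurable (μ := P))
      have hone : (fun ω => E.indicator (1 : S × Ω → ℝ≥0∞) (u, ω)) +
          (fun ω => Eᶜ.indicator (1 : S × Ω → ℝ≥0∞) (u, ω)) = 1 := by
        funext ω
        by_cases h : (u, ω) ∈ E <;> simp [h]
      rw [hone, condLExp_one hm] at hadd
      filter_upwards [hadd, hGe u] with ω h1 h2
      rw [h2]
      simp only [Pi.one_apply, Pi.add_apply] at h1
      rw [h1]
      refine ENNReal.add_sub_cancel_left (ne_top_of_le_ne_top ENNReal.one_ne_top ?_)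
      rw [h1]
      exact le_self_add
    · intro E hdis hE hG
      choose G hG hGe using hG
      refine ⟨fun z => ∑' n, G n z, Measurable.tsum hG, fun u => ?_⟩
      have hsum : (fun ω => (⋃ n, E n).indicator (1 : S × Ω → ℝ≥0∞) (u, ω)) =
          ∑' n, fun ω => (E n).indicator (1 : S × Ω → ℝ≥0∞) (u, ω) := by
        funext ω
        rw [ENNReal.tsum_apply, indicator_iUnion_of_pairwise_disjoint _ hdis]
      rw [hsum]
      refine EventuallyEq.symm ((condLExp_tsum _ fun n =>
        ((measurable_one.indicator (hE n)).comp measurable_prodMk_left).aemeasurable).trans ?_)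
      filter_upwards [ae_all_iff.2 fun n => hGe n u] with ω hω
      rw [ENNReal.tsum_apply]
      exact tsum_congr fun n => (hω n).symm
  refine hf.ennreal_induction ?_ ?_ ?_
  · intro c E hE
    obtain ⟨G, hG, hGe⟩ := hset E hE
    refine ⟨fun z => c * G z, hG.const_mul c, fun u => ?_⟩
    have : (fun ω => E.indicator (fun _ => c) (u, ω)) =
        c • fun ω => E.indicator (1 : S × Ω → ℝ≥0∞) (u, ω) := by
      funext ω
      by_cases h : (u, ω) ∈ E <;> simp [h]
    rw [this]
    refine EventuallyEq.symm ((condLExp_smul _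
      ((measurable_one.indicator hE).comp measurable_prodMk_left).aemeasurable c).trans ?_)
    filter_upwards [hGe u] with ω hω
    exact congrArg (c * ·) hω.symm
  · intro f g _ hf hg ihf ihg
    obtain ⟨F, hF, hFe⟩ := ihf
    obtain ⟨G, hG, hGe⟩ := ihg
    refine ⟨F + G, hF.add hG, fun u => ?_⟩
    refine EventuallyEq.symm ((condLExp_add_left (fun ω => g (u, ω))
      (hf.comp measurable_prodMk_left).aemeasurable).trans ?_)
    filter_upwards [hFe u, hGe u] with ω h1 h2
    exact (congrArg₂ (· + ·) h1 h2).symm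
  · intro f hf hmono ih
    choose G hG hGe using ih
    refine ⟨fun z => ⨆ n, G n z, Measurable.iSup hG, fun u => ?_⟩
    have hGu (n : ℕ) : Measurable fun ω => G n (u, Y ω) :=
      (hG n).comp (measurable_const.prodMk hY)
    refine ae_eq_condLExp hm P _ ?_ fun s hs => ?_
    · exact (Measurable.iSup hG).comp (measurable_const.prodMk (comap_measurable Y))
    -- The versions are chosen separately for each `n`, so they increase only almost surely along
    -- `Y`; this suffices for monotone convergence.
    · have hGmono : ∀ᵐ ω ∂P, Monotone fun n => G n (u, Y ω) := by
        have : ∀ n, ∀ᵐ ω ∂P, G n (u, Y ω) ≤ G (n + 1) (u, Y ω) := fun n => by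
          filter_upwards [hGe n u, hGe (n + 1) u,
            condLExp_mono (mΩ := MeasurableSpace.comap Y inferInstance) (P := P)
              (ae_of_all P fun ω => hmono n.le_succ (u, ω))] with ω h1 h2 h3
          rw [h1, h2]
          exact h3
        filter_upwards [ae_all_iff.2 this] with ω hω using monotone_nat_of_le_succ hω
      rw [lintegral_iSup' (fun n => (hGu n).aemeasurable) (ae_restrict_of_ae hGmono),
        lintegral_iSup (f := fun n ω => f n (u, ω))
          (fun n => (hf n).comp measurable_prodMk_left) fun a b hab ω => hmono hab (u, ω)]
      refine iSup_congr fun n => ?_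
      rw [← setLIntegral_condLExp hm P (fun ω => f n (u, ω)) hs]
      exact lintegral_congr_ae (ae_restrict_of_ae (hGe n u))

end

section

variable {Ω : Type*} {m m₀ : MeasurableSpace Ω} {P : Measure[m₀] Ω}

/-- If `Z` is `m`-measurable, `Y` and `Z` are bounded by `C` and agree off `N`, then
`Z * E[Y / Z | m]` is bounded by `C` and differs from `Z` by at most `C * P(N | m)`. -/
theorem condLExp_div_mul_bounds (hm : m ≤ m₀) [SigmaFinite (P.trim hm)] {Y Z : Ω → ℝ≥0∞}
    (hY : Measurable[m₀] Y) (hZ : Measurable[m] Z) {C : ℝ≥0} (hYC : ∀ ω, Y ω ≤ C)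
    (hZC : ∀ ω, Z ω ≤ C) {N : Set Ω} (hN : MeasurableSet[m₀] N) (hYZ : ∀ ω, ω ∉ N → Y ω = Z ω) :
    ∀ᵐ ω ∂P, condLExp m P (fun ω => Y ω / Z ω) ω * Z ω ≤ C ∧
      condLExp m P (fun ω => Y ω / Z ω) ω * Z ω ≤ Z ω + C * condLExp m P (N.indicator 1) ω ∧
      Z ω ≤ condLExp m P (fun ω => Y ω / Z ω) ω * Z ω + C * condLExp m P (N.indicator 1) ω := by
  have hZ₀ : Measurable[m₀] Z := hZ.mono hm le_rfl
  have hZtop (ω) : Z ω ≠ ∞ := ne_top_of_le_ne_top ENNReal.coe_ne_top (hZC ω)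
  have hR : Measurable[m₀] fun ω => Y ω / Z ω := hY.div hZ₀
  have hpull := condLExp_mul_right hm (P := P) hR hZ
  -- Where `Z` vanishes the quotient may be `∞`, but `∞ * 0 = 0`; no lower bound on `Z` is needed.
  have hle (ω) : Y ω / Z ω * Z ω ≤ C := by
    by_cases h0 : Z ω = 0
    · simp [h0]
    · rw [ENNReal.div_mul_cancel h0 (hZtop ω)]; exact hYC ω
  have hoff (ω) (hω : ω ∉ N) : Y ω / Z ω * Z ω = Z ω := by
    by_cases h0 : Z ω = 0
    · simp [h0]
    · rw [ENNReal.div_mul_cancel h0 (hZtop ω), hYZ ω hω]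
  have hCN : Measurable[m₀] ((C : ℝ≥0∞) • N.indicator (1 : Ω → ℝ≥0∞)) :=
    (measurable_one.indicator hN).const_mul _
  have hbd := condLExp_mono (mΩ := m) (P := P) (ae_of_all P hle)
  have hup := condLExp_mono (mΩ := m) (P := P) (X := fun ω => Y ω / Z ω * Z ω)
    (Y := Z + (C : ℝ≥0∞) • N.indicator (1 : Ω → ℝ≥0∞)) (ae_of_all P fun ω => by
      by_cases hω : ω ∈ N
      · simpa [hω] using (hle ω).trans le_add_self
      · simp [hω, hoff ω hω])
  have hlo := condLExp_mono (mΩ := m) (P := P) (X := Z)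
    (Y := (fun ω => Y ω / Z ω * Z ω) + (C : ℝ≥0∞) • N.indicator (1 : Ω → ℝ≥0∞))
    (ae_of_all P fun ω => by
      by_cases hω : ω ∈ N
      · simpa [hω] using (hZC ω).trans le_add_self
      · simp [hω, hoff ω hω])
  have hadd := condLExp_add_right (mΩ := m) (P := P) Z hCN.aemeasurable
  have hadd' := condLExp_add_right (mΩ := m) (P := P) (fun ω => Y ω / Z ω * Z ω) hCN.aemeasurable
  have hsm := condLExp_smul' (mΩ := m) (P := P) (N.indicator (1 : Ω → ℝ≥0∞))
    (ENNReal.coe_ne_top (r := C))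
  rw [condLExp_const hm] at hbd
  rw [condLExp_eq_self hm P hZ] at hlo hadd
  filter_upwards [hpull, hbd, hup, hlo, hadd, hadd', hsm] with ω h1 h2 h3 h4 h5 h6 h7
  simp only [Pi.add_apply, Pi.smul_apply, smul_eq_mul] at h5 h6 h7
  rw [h7] at h5 h6
  rw [h5, h1] at h3
  rw [h6, h1] at h4
  rw [h1] at h2
  exact ⟨h2, h3, h4⟩

end

/-! ### The weighted estimator in one fold -/

section

variable {S : Type*} [MetricSpace S] [MeasurableSpace S] {Ω : Type*} [MeasurableSpace Ω]
  {μ : Measure S} {P : Measure Ω} {X : Ω → Config S} {lam : S → Config S → ℝ≥0}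
  {A B : Set S} {V : S → Config S → ℝ≥0∞}

theorem measurable_blockTraining (hX : Measurable X) (hA : MeasurableSet A)
    (hB : MeasurableSet B) : Measurable fun ω => blockTraining ((X ω).restrict A) B := by
  simp_rw [blockTraining_restrict]
  exact (Config.measurable_restrict (hA.diff hB)).comp hX

/-- Training and validation sets reunite to `X ∩ A`, so the ratio is jointly measurable in `(u, ω)`
and `exists_measurable_condLExp_comap` applies. -/
theorem exists_isPPLWeight [IsProbabilityMeasure P] (hX : Measurable X)
    (hlam : Measurable (Function.uncurry lam)) (hA : MeasurableSet A) (hB : MeasurableSet B) :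
    ∃ V : S → Config S → ℝ≥0∞, IsPPLWeight μ P lam (blockRetention B)
      (fun ω => blockTraining ((X ω).restrict A) B)
      (fun ω => blockValidation ((X ω).restrict A) B) V := by
  have hT := measurable_blockTraining hX hA hB
  have hXA : Measurable fun ω => (X ω).restrict A := (Config.measurable_restrict hA).comp hX
  obtain ⟨G, hG, hGe⟩ := exists_measurable_condLExp_comap P hT
    (f := fun z : S × Ω => (lam z.1 ((X z.2).restrict A) : ℝ≥0∞) /
      (lam z.1 (blockTraining ((X z.2).restrict A) B) : ℝ≥0∞))
    ((hlam.comp (measurable_fst.prodMk (hXA.comp measurable_snd))).coe_nnreal_ennreal.div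
      (hlam.comp (measurable_fst.prodMk (hT.comp measurable_snd))).coe_nnreal_ennreal)
  refine ⟨fun u y => blockRetention B u * G (u, y),
    ((measurable_const.indicator hB).comp measurable_fst).mul hG, ae_of_all _ fun u => ?_⟩
  simp_rw [blockTraining_union_blockValidation]
  filter_upwards [hGe u] with ω hω
  rw [hω]

variable {C : ℝ≥0}

/-- Here `q` is the conditional probability, given the training set, that the cell is hit. It does
not depend on `u`, so one function controls the whole cell. -/
theorem IsPPLWeight.ae_bounds [IsProbabilityMeasure P] (hX : Measurable X)
    (hlam : Measurable (Function.uncurry lam)) (hC : ∀ u x, lam u x ≤ C)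
    (hA : MeasurableSet A) (hB : MeasurableSet B) (hb : Bornology.IsBounded B)
    (hV : IsPPLWeight μ P lam (blockRetention B)
      (fun ω => blockTraining ((X ω).restrict A) B)
      (fun ω => blockValidation ((X ω).restrict A) B) V) :
    ∃ q : Ω → ℝ≥0∞, Measurable q ∧ ∫⁻ ω, q ω ∂P = P {ω | ((X ω).pts ∩ B).ncard ≠ 0} ∧
      ∀ᵐ u ∂μ, ∀ᵐ ω ∂P,
        (u ∉ B → V u (blockTraining ((X ω).restrict A) B) = 0) ∧
        V u (blockTraining ((X ω).restrict A) B) * lam u (blockTraining ((X ω).restrict A) B) ≤ C ∧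
        (u ∈ B →
          V u (blockTraining ((X ω).restrict A) B) * lam u (blockTraining ((X ω).restrict A) B) ≤
            lam u (blockTraining ((X ω).restrict A) B) + C * q ω ∧
          (lam u (blockTraining ((X ω).restrict A) B) : ℝ≥0∞) ≤
            V u (blockTraining ((X ω).restrict A) B) * lam u (blockTraining ((X ω).restrict A) B) +
              C * q ω) := by
  have hT := measurable_blockTraining hX hA hB
  have hXA : Measurable fun ω => (X ω).restrict A := (Config.measurable_restrict hA).comp hX
  have hN : MeasurableSet {ω | ((X ω).pts ∩ B).ncard ≠ 0} :=
    ((Config.measurable_ncard hB hb).comp hX) (measurableSet_singleton 0).compl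
  refine ⟨condLExp (MeasurableSpace.comap (fun ω => blockTraining ((X ω).restrict A) B)
    inferInstance) P ({ω | ((X ω).pts ∩ B).ncard ≠ 0}.indicator 1), measurable_condLExp' _ _ _,
    ?_, ?_⟩
  · rw [lintegral_condLExp hT.comap_le, lintegral_indicator_one hN]
  · filter_upwards [hV.2] with u hu
    have hlamu : Measurable (lam u) := hlam.comp measurable_prodMk_left
    have hbd := condLExp_div_mul_bounds (P := P) hT.comap_le
      (Y := fun ω => (lam u ((X ω).restrict A) : ℝ≥0∞))
      (Z := fun ω => (lam u (blockTraining ((X ω).restrict A) B) : ℝ≥0∞)) (C := C)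
      (hlamu.comp hXA).coe_nnreal_ennreal
      (hlamu.comp (comap_measurable _)).coe_nnreal_ennreal
      (fun ω => by exact_mod_cast hC _ _) (fun ω => by exact_mod_cast hC _ _) hN
      (fun ω hω => by
        rw [blockTraining_eq_of_ncard_eq_zero (X ω) hb (not_not.1 hω)])
    simp_rw [blockTraining_union_blockValidation] at hu
    filter_upwards [hu, hbd] with ω h1 h2
    by_cases huB : u ∈ B
    · simp only [blockRetention, Set.indicator_of_mem huB, one_mul] at h1
      rw [h1]
      exact ⟨fun h => absurd huB h, h2.1, fun _ => h2.2⟩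
    · simp only [blockRetention, Set.indicator_of_notMem huB, zero_mul] at h1
      rw [h1]
      simp [huB]

theorem enorm_toReal_sub_le {w c : ℝ≥0∞} {z : ℝ≥0} (h₁ : w ≤ z + c) (h₂ : z ≤ w + c) :
    ‖w.toReal - z‖ₑ ≤ c := by
  rcases eq_or_ne c ∞ with rfl | hc
  · exact le_top
  have hw : w ≠ ∞ := ne_top_of_le_ne_top (by simp [hc]) h₁
  lift c to ℝ≥0 using hc
  lift w to ℝ≥0 using hw
  norm_cast at h₁ h₂
  rw [enorm_le_coe, ← NNReal.coe_le_coe, coe_nnnorm, Real.norm_eq_abs, ENNReal.coe_toReal, abs_le]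
  rw [← NNReal.coe_le_coe] at h₁ h₂
  push_cast at h₁ h₂
  constructor <;> linarith

variable {h : S → Config S → ℝ} {H C₀ : ℝ≥0} {lam₀ : S → Config S → ℝ≥0}

theorem measurable_uncurry_mul_weightedEstimator (hX : Measurable X)
    (hlam : Measurable (Function.uncurry lam)) (hh : Measurable (Function.uncurry h))
    (hA : MeasurableSet A) (hB : MeasurableSet B) (hV : Measurable (Function.uncurry V)) :
    Measurable fun z : S × Ω => h z.1 (blockTraining ((X z.2).restrict A) B) *
      weightedEstimator lam V z.1 (blockTraining ((X z.2).restrict A) B) := by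
  have hp : Measurable fun z : S × Ω => (z.1, blockTraining ((X z.2).restrict A) B) :=
    measurable_fst.prodMk ((measurable_blockTraining hX hA hB).comp measurable_snd)
  exact (hh.comp hp).mul ((hV.comp hp).mul (hlam.comp hp).coe_nnreal_ennreal).ennreal_toReal

theorem measurable_uncurry_mul_restrict (hX : Measurable X)
    (hlam : Measurable (Function.uncurry lam)) (hh : Measurable (Function.uncurry h))
    (hA : MeasurableSet A) :
    Measurable fun z : S × Ω => h z.1 ((X z.2).restrict A) * (lam z.1 ((X z.2).restrict A) : ℝ) := by
  have hp : Measurable fun z : S × Ω => (z.1, (X z.2).restrict A) :=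
    measurable_fst.prodMk (((Config.measurable_restrict hA).comp hX).comp measurable_snd)
  exact (hh.comp hp).mul (hlam.comp hp).coe_nnreal_real

/-- The expected error made in a cell by replacing the intensity given the whole configuration by
the weighted estimator given the training configuration is of second order in the size of the
cell. -/
theorem IsPPLWeight.lintegral_error_le [SFinite μ] [IsProbabilityMeasure P] (hX : Measurable X)
    (hX₀ : IsConditionalIntensity μ P X lam₀) (hC₀ : ∀ u x, lam₀ u x ≤ C₀)
    (hlam : Measurable (Function.uncurry lam)) (hC : ∀ u x, lam u x ≤ C)
    (hh : Measurable (Function.uncurry h)) (hH : ∀ u x, ‖h u x‖ₑ ≤ H)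
    (hA : MeasurableSet A) (hB : MeasurableSet B) (hb : Bornology.IsBounded B)
    (hV : IsPPLWeight μ P lam (blockRetention B)
      (fun ω => blockTraining ((X ω).restrict A) B)
      (fun ω => blockValidation ((X ω).restrict A) B) V) :
    ∫⁻ ω, ∫⁻ u in B, ‖h u (blockTraining ((X ω).restrict A) B) *
        weightedEstimator lam V u (blockTraining ((X ω).restrict A) B) -
        h u ((X ω).restrict A) * lam u ((X ω).restrict A)‖ₑ ∂μ ∂P ≤
      3 * H * C * C₀ * μ B * μ B := by
  obtain ⟨q, hq, hqN, hae⟩ := hV.ae_bounds hX hlam hC hA hB hb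
  set N : Set Ω := {ω | ((X ω).pts ∩ B).ncard ≠ 0}
  have hN : MeasurableSet N :=
    ((Config.measurable_ncard hB hb).comp hX) (measurableSet_singleton 0).compl
  have hlamC (u x) : ‖(lam u x : ℝ)‖ₑ ≤ C := by
    rw [enorm_le_coe, ← NNReal.coe_le_coe, coe_nnnorm, NNReal.norm_eq]
    exact_mod_cast hC u x
  have hmeas : Measurable fun z : S × Ω => ‖h z.1 (blockTraining ((X z.2).restrict A) B) *
        weightedEstimator lam V z.1 (blockTraining ((X z.2).restrict A) B) -
        h z.1 ((X z.2).restrict A) * lam z.1 ((X z.2).restrict A)‖ₑ :=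
    ((measurable_uncurry_mul_weightedEstimator hX hlam hh hA hB hV.1).sub
      (measurable_uncurry_mul_restrict hX hlam hh hA)).enorm
  -- The weight is determined for almost every `u` and then almost every `ω`, so the inner integral
  -- must be the one over `ω`.
  rw [lintegral_lintegral_swap (by exact (hmeas.comp measurable_swap).aemeasurable)]
  have hbound : ∀ᵐ u ∂μ.restrict B, ∫⁻ ω, ‖h u (blockTraining ((X ω).restrict A) B) *
        weightedEstimator lam V u (blockTraining ((X ω).restrict A) B) -
        h u ((X ω).restrict A) * lam u ((X ω).restrict A)‖ₑ ∂P ≤ 3 * H * C * C₀ * μ B := by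
    filter_upwards [ae_restrict_of_ae hae, ae_restrict_mem hB] with u hu huB
    -- The first term pays for replacing the estimator by the intensity given the training set, the
    -- second for replacing the training set by `X ∩ A`. Both `q` and the indicator integrate to `P
    -- N`, whence `3 = 1 + 2`.
    calc _ ≤ ∫⁻ ω, (H * (C * q ω) + 2 * H * C * N.indicator 1 ω) ∂P := by
          refine lintegral_mono_ae ?_
          filter_upwards [hu] with ω hω
          set T := blockTraining ((X ω).restrict A) B with hT
          have hsplit : h u T * weightedEstimator lam V u T -
              h u ((X ω).restrict A) * lam u ((X ω).restrict A) =
              h u T * ((V u T * lam u T).toReal - lam u T) +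
              (h u T * lam u T - h u ((X ω).restrict A) * lam u ((X ω).restrict A)) := by
            simp only [weightedEstimator]; ring
          rw [hsplit]
          refine (enorm_add_le _ _).trans (add_le_add ?_ ?_)
          · rw [enorm_mul]
            exact mul_le_mul' (hH _ _) (enorm_toReal_sub_le (hω.2.2 huB).1 (hω.2.2 huB).2)
          · by_cases hωN : ω ∈ N
            · rw [Set.indicator_of_mem hωN]
              refine (enorm_sub_le (E := ℝ)).trans ?_
              rw [enorm_mul, enorm_mul]
              calc _ ≤ (H : ℝ≥0∞) * C + H * C := by
                    gcongr <;> first | exact hH _ _ | exact hlamC _ _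
                _ = _ := by simp; ring
            · rw [hT, blockTraining_eq_of_ncard_eq_zero (X ω) hb (not_not.1 hωN)]
              simp
      _ = 3 * H * C * P N := by
          rw [lintegral_add_left ((hq.const_mul _).const_mul _),
            lintegral_const_mul _ (hq.const_mul _), lintegral_const_mul _ hq,
            lintegral_const_mul _ (measurable_one.indicator hN), lintegral_indicator_one hN, hqN]
          ring
      _ ≤ 3 * H * C * (C₀ * μ B) := by
          gcongr
          exact hX₀.measure_ncard_ne_zero_le hX hC₀ hB hb
      _ = _ := by ring
  calc _ ≤ ∫⁻ _ in B, 3 * H * C * C₀ * μ B ∂μ := lintegral_mono_ae hbound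
    _ = _ := by simp

/-- Prediction errors integrate over `u` at fixed `ω`, so the null sets have to be exchanged by
Fubini. -/
theorem IsPPLWeight.ae_ae_bounds [SFinite μ] [IsProbabilityMeasure P] (hX : Measurable X)
    (hlam : Measurable (Function.uncurry lam)) (hC : ∀ u x, lam u x ≤ C)
    (hA : MeasurableSet A) (hB : MeasurableSet B) (hb : Bornology.IsBounded B)
    (hV : IsPPLWeight μ P lam (blockRetention B)
      (fun ω => blockTraining ((X ω).restrict A) B)
      (fun ω => blockValidation ((X ω).restrict A) B) V) :
    ∀ᵐ ω ∂P, ∀ᵐ u ∂μ, (u ∉ B → V u (blockTraining ((X ω).restrict A) B) = 0) ∧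
      V u (blockTraining ((X ω).restrict A) B) *
        lam u (blockTraining ((X ω).restrict A) B) ≤ C := by
  obtain ⟨q, -, -, hae⟩ := hV.ae_bounds hX hlam hC hA hB hb
  have hp : Measurable fun z : S × Ω => (z.1, blockTraining ((X z.2).restrict A) B) :=
    measurable_fst.prodMk ((measurable_blockTraining hX hA hB).comp measurable_snd)
  have hVm : Measurable fun z : S × Ω => V z.1 (blockTraining ((X z.2).restrict A) B) :=
    hV.1.comp hp
  have hlamm : Measurable fun z : S × Ω => lam z.1 (blockTraining ((X z.2).restrict A) B) :=
    hlam.comp hp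
  rw [← Measure.ae_ae_comm]
  · filter_upwards [hae] with u hu
    filter_upwards [hu] with ω hω using ⟨hω.1, hω.2.1⟩
  · have h₁ : MeasurableSet {z : S × Ω | V z.1 (blockTraining ((X z.2).restrict A) B) = 0} :=
      hVm (measurableSet_singleton 0)
    have h₂ : MeasurableSet {z : S × Ω | z.1 ∉ B} := measurable_fst hB.compl
    exact MeasurableSet.inter (h₂.imp h₁) (measurableSet_le (hVm.mul hlamm.coe_nnreal_ennreal) measurable_const)

theorem IsPPLWeight.ae_integrableOn [SFinite μ] [IsProbabilityMeasure P] (hX : Measurable X)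
    (hlam : Measurable (Function.uncurry lam)) (hC : ∀ u x, lam u x ≤ C)
    (hh : Measurable (Function.uncurry h)) (hH : ∀ u x, ‖h u x‖ₑ ≤ H)
    (hA : MeasurableSet A) (hμA : μ A < ∞) (hB : MeasurableSet B) (hb : Bornology.IsBounded B)
    (hV : IsPPLWeight μ P lam (blockRetention B)
      (fun ω => blockTraining ((X ω).restrict A) B)
      (fun ω => blockValidation ((X ω).restrict A) B) V) :
    ∀ᵐ ω ∂P, IntegrableOn (fun u => h u (blockTraining ((X ω).restrict A) B) *
      weightedEstimator lam V u (blockTraining ((X ω).restrict A) B)) A μ := by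
  filter_upwards [hV.ae_ae_bounds hX hlam hC hA hB hb] with ω hω
  refine IntegrableOn.of_bound hμA ((measurable_uncurry_mul_weightedEstimator hX hlam hh hA hB
    hV.1).comp measurable_prodMk_right).aestronglyMeasurable (H * C) (ae_restrict_of_ae ?_)
  filter_upwards [hω] with u hu
  rw [norm_mul]
  refine mul_le_mul ?_ ?_ (norm_nonneg _) H.2
  · exact enorm_le_coe.1 (hH _ _)
  · rw [weightedEstimator, Real.norm_of_nonneg ENNReal.toReal_nonneg]
    exact ENNReal.toReal_mono ENNReal.coe_ne_top hu.2

end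

/-! ### Deterministic comparison and convergence in probability -/

section

variable {S : Type*} [MeasurableSpace S] {μ : Measure S} {A : Set S}

theorem sum_measure_mul_self_le {k : ℕ} {c : Fin k → Set S} (hc : IsCellPartition A c) :
    ∑ i, μ (c i) * μ (c i) ≤ (⨆ i, μ (c i)) * μ A := by
  rw [← hc.iUnion_eq, measure_iUnion hc.disjoint hc.measurable, tsum_fintype, Finset.mul_sum]
  gcongr with i
  exact le_iSup (fun i => μ (c i)) i

variable [MetricSpace S]

/-- If every cell has at most one point, then the sums over the points in the prediction errors of
block cross-validation add up to that of the whole configuration, and the error is governed by the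
integrals. -/
theorem enorm_sum_predictionError_sub_le {k : ℕ} {c : Fin k → Set S} (hc : IsCellPartition A c)
    (hA : Bornology.IsBounded A) (x : Config S) {h lam : S → Config S → ℝ}
    {ξ : Fin k → S → Config S → ℝ} (hx : ∀ i, (x.pts ∩ c i).ncard < 2)
    (hint : ∀ i, IntegrableOn (fun u => h u (blockTraining (x.restrict A) (c i)) *
      ξ i u (blockTraining (x.restrict A) (c i))) A μ)
    (hint' : IntegrableOn (fun u => h u (x.restrict A) * lam u (x.restrict A)) A μ)
    (hξ : ∀ i, ∀ᵐ u ∂μ, u ∉ c i → ξ i u (blockTraining (x.restrict A) (c i)) = 0) :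
    ‖(∑ i, predictionError μ h (ξ i) A (blockValidation (x.restrict A) (c i))
        (blockTraining (x.restrict A) (c i))) -
      predictionError μ h lam A (x.restrict A) (x.restrict A)‖ₑ ≤
      ∑ i, ∫⁻ u in c i, ‖h u (blockTraining (x.restrict A) (c i)) *
        ξ i u (blockTraining (x.restrict A) (c i)) -
        h u (x.restrict A) * lam u (x.restrict A)‖ₑ ∂μ := by
  have hcA (i) : c i ⊆ A := hc.iUnion_eq ▸ Set.subset_iUnion c i
  have hpts (i) : (blockValidation (x.restrict A) (c i)).pts ∩ A = x.pts ∩ c i := by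
    ext u
    have := @hcA i u
    simp only [blockValidation, Config.restrict, Set.mem_inter_iff]
    tauto
  have hAm : MeasurableSet A := hc.iUnion_eq ▸ MeasurableSet.iUnion hc.measurable
  have hsum : ∑ i, ∑ᶠ u ∈ (blockValidation (x.restrict A) (c i)).pts ∩ A,
      h u ((blockTraining (x.restrict A) (c i)).erase u) =
      ∑ᶠ u ∈ (x.restrict A).pts ∩ A, h u ((x.restrict A).erase u) := by
    have hU : (x.restrict A).pts ∩ A = ⋃ i, x.pts ∩ c i := by
      rw [← Set.inter_iUnion, hc.iUnion_eq, Config.restrict, Set.inter_assoc, Set.inter_self]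
    rw [hU, finsum_mem_iUnion
      (fun i j hij => (hc.disjoint hij).mono Set.inter_subset_right Set.inter_subset_right)
      (fun i => x.finite_inter' _ (hA.subset (hcA i))), finsum_eq_sum_of_fintype]
    refine Finset.sum_congr rfl fun i _ => ?_
    rw [hpts]
    refine finsum_mem_congr rfl fun u hu => ?_
    rw [blockTraining_erase_eq_of_ncard_lt_two x (hA.subset (hcA i)) (hx i) hu]
  have hwhole : ∫ u in A, h u (x.restrict A) * lam u (x.restrict A) ∂μ =
      ∑ i, ∫ u in c i, h u (x.restrict A) * lam u (x.restrict A) ∂μ := by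
    rw [← integral_iUnion_fintype hc.measurable hc.disjoint fun i => hint'.mono_set (hcA i),
      hc.iUnion_eq]
  -- The weight vanishes off its own cell, which leaves each cell counted by exactly one fold.
  have hfold (i) : ∫ u in A, h u (blockTraining (x.restrict A) (c i)) *
      ξ i u (blockTraining (x.restrict A) (c i)) ∂μ =
      ∫ u in c i, h u (blockTraining (x.restrict A) (c i)) *
        ξ i u (blockTraining (x.restrict A) (c i)) ∂μ := by
    refine setIntegral_eq_of_subset_of_ae_sdiff_eq_zero hAm.nullMeasurableSet (hcA i) ?_
    filter_upwards [hξ i] with u hu huA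
    rw [hu huA.2, mul_zero]
  have heq : (∑ i, predictionError μ h (ξ i) A (blockValidation (x.restrict A) (c i))
        (blockTraining (x.restrict A) (c i))) -
      predictionError μ h lam A (x.restrict A) (x.restrict A) =
      -∑ i, ∫ u in c i, (h u (blockTraining (x.restrict A) (c i)) *
        ξ i u (blockTraining (x.restrict A) (c i)) -
        h u (x.restrict A) * lam u (x.restrict A)) ∂μ := by
    simp only [predictionError]
    rw [Finset.sum_sub_distrib, hsum, hwhole]
    simp_rw [hfold]
    rw [Finset.sum_congr rfl fun i _ =>
      integral_sub ((hint i).mono_set (hcA i)) (hint'.mono_set (hcA i)), Finset.sum_sub_distrib]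
    ring
  rw [heq, enorm_neg]
  exact (enorm_sum_le _ _).trans
    (Finset.sum_le_sum fun i _ => enorm_integral_le_lintegral_enorm _)

end

theorem theorem2 {S : Type*} [MetricSpace S] [CompleteSpace S] [TopologicalSpace.SeparableSpace S]
    [MeasurableSpace S] [BorelSpace S]
    (μ : Measure S) [NullSingletonClass μ] [SigmaFinite μ]
    (hμ : ∀ B : Set S, Bornology.IsBounded B → μ B < ∞)
    {Ω : Type*} [MeasurableSpace Ω] (P : Measure Ω) [IsProbabilityMeasure P]
    (X : Ω → Config S) (hX : Measurable X)
    {Θ : Type*} (lam : Θ → S → Config S → ℝ≥0) (h : Θ → S → Config S → ℝ)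
    (hlam_meas : ∀ θ, Measurable (Function.uncurry (lam θ)))
    (hh_meas : ∀ θ, Measurable (Function.uncurry (h θ)))
    (θ₀ : Θ) (hX_int : IsConditionalIntensity μ P X (lam θ₀))
    (hlam_bdd : ∀ θ, ∃ C : ℝ≥0, ∀ u x, lam θ u x ≤ C)
    (hh_bdd : ∀ θ, ∃ C : ℝ, ∀ u x, |h θ u x| ≤ C)
    (A : Set S) (hA : MeasurableSet A) (hA_bdd : Bornology.IsBounded A)
    (cell : (k : ℕ) → Fin k → Set S)
    (hcell : ∀ k, 2 ≤ k → IsCellPartition A (cell k))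
    (hcell_size : Tendsto (fun k => ⨆ i : Fin k, μ (cell k i)) atTop (𝓝 0))
    (hcell_refine : ∀ k, 2 ≤ k → ∀ j : Fin (k + 1), ∃ i : Fin k, cell (k + 1) j ⊆ cell k i)
    (θ : Θ) :
    (∀ k, 2 ≤ k → ∀ i : Fin k, ∃ V : S → Config S → ℝ≥0∞,
      IsPPLWeight μ P (lam θ) (blockRetention (cell k i))
        (fun ω => blockTraining ((X ω).restrict A) (cell k i))
        (fun ω => blockValidation ((X ω).restrict A) (cell k i)) V) ∧
    ∀ V : (k : ℕ) → Fin k → S → Config S → ℝ≥0∞,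
      (∀ k, 2 ≤ k → ∀ i : Fin k,
        IsPPLWeight μ P (lam θ) (blockRetention (cell k i))
          (fun ω => blockTraining ((X ω).restrict A) (cell k i))
          (fun ω => blockValidation ((X ω).restrict A) (cell k i)) (V k i)) →
      (∀ k, 2 ≤ k → ∀ i : Fin k, ∀ᵐ ω ∂P,
        IntegrableOn (fun u =>
          h θ u (blockTraining ((X ω).restrict A) (cell k i)) *
            weightedEstimator (lam θ) (V k i) u
              (blockTraining ((X ω).restrict A) (cell k i))) A μ) ∧
      TendstoInMeasure P
        (fun k ω =>
          (∑ i : Fin k,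
            predictionError μ (h θ) (weightedEstimator (lam θ) (V k i)) A
              (blockValidation ((X ω).restrict A) (cell k i))
              (blockTraining ((X ω).restrict A) (cell k i))) -
          predictionError μ (h θ) (fun u y => (lam θ u y : ℝ)) A
            ((X ω).restrict A) ((X ω).restrict A))
        atTop (fun _ => 0) := by
  obtain ⟨C₀, hC₀⟩ := hlam_bdd θ₀
  obtain ⟨C, hC⟩ := hlam_bdd θ
  obtain ⟨H, hH⟩ : ∃ H : ℝ≥0, ∀ u x, ‖h θ u x‖ₑ ≤ H := by
    obtain ⟨H, hH⟩ := hh_bdd θ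
    refine ⟨H.toNNReal, fun u x => ?_⟩
    rw [enorm_le_coe, ← NNReal.coe_le_coe, coe_nnnorm]
    exact (hH u x).trans (Real.le_coe_toNNReal H)
  have hμA := hμ A hA_bdd
  have hcA (k) (hk : 2 ≤ k) (i) : cell k i ⊆ A :=
    (hcell k hk).iUnion_eq ▸ Set.subset_iUnion (cell k) i
  have hcb (k) (hk : 2 ≤ k) (i) : Bornology.IsBounded (cell k i) := hA_bdd.subset (hcA k hk i)
  refine ⟨fun k hk i => exists_isPPLWeight hX (hlam_meas θ) hA ((hcell k hk).measurable i),
    fun V hV => ?_⟩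
  have hint (k) (hk : 2 ≤ k) (i) := (hV k hk i).ae_integrableOn hX (hlam_meas θ) hC (hh_meas θ) hH
    hA hμA ((hcell k hk).measurable i) (hcb k hk i)
  refine ⟨hint, tendstoInMeasure_of_ne_top fun ε hε hε' => ?_⟩
  -- `C₀ ^ 2` accounts for cells with two points, and the term over `ε` is Markov's inequality for
  -- the integral errors.
  have hlim : Tendsto (fun k => (C₀ ^ 2 + 3 * H * C * C₀ / ε) *
      ((⨆ i : Fin k, μ (cell k i)) * μ A)) atTop (𝓝 0) := by
    have hK : (C₀ ^ 2 + 3 * H * C * C₀ / ε : ℝ≥0∞) ≠ ∞ :=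
      ENNReal.add_ne_top.2 ⟨by finiteness, ENNReal.div_ne_top (by finiteness) hε.ne'⟩
    simpa using ENNReal.Tendsto.const_mul
      (ENNReal.Tendsto.mul_const hcell_size (Or.inr hμA.ne)) (Or.inr hK)
  refine tendsto_of_tendsto_of_tendsto_of_le_of_le' tendsto_const_nhds hlim
    (Eventually.of_forall fun _ => zero_le) ?_
  filter_upwards [eventually_ge_atTop 2] with k hk
  set D : Fin k → Ω → ℝ≥0∞ := fun i ω => ∫⁻ u in cell k i,
    ‖h θ u (blockTraining ((X ω).restrict A) (cell k i)) *
      weightedEstimator (lam θ) (V k i) u (blockTraining ((X ω).restrict A) (cell k i)) -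
      h θ u ((X ω).restrict A) * lam θ u ((X ω).restrict A)‖ₑ ∂μ
  have hDm (i) : Measurable (D i) :=
    Measurable.lintegral_prod_left' (μ := μ.restrict (cell k i))
      ((measurable_uncurry_mul_weightedEstimator hX (hlam_meas θ) (hh_meas θ) hA
        ((hcell k hk).measurable i) (hV k hk i).1).sub
        (measurable_uncurry_mul_restrict hX (hlam_meas θ) (hh_meas θ) hA)).enorm
  have hgood : ∀ᵐ ω ∂P, (∀ i, ((X ω).pts ∩ cell k i).ncard < 2) →
      ‖(∑ i, predictionError μ (h θ) (weightedEstimator (lam θ) (V k i)) A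
          (blockValidation ((X ω).restrict A) (cell k i))
          (blockTraining ((X ω).restrict A) (cell k i))) -
        predictionError μ (h θ) (fun u y => (lam θ u y : ℝ)) A
          ((X ω).restrict A) ((X ω).restrict A)‖ₑ ≤ ∑ i, D i ω := by
    filter_upwards [ae_all_iff.2 (hint k hk), ae_all_iff.2 fun i => (hV k hk i).ae_ae_bounds hX
      (hlam_meas θ) hC hA ((hcell k hk).measurable i) (hcb k hk i)] with ω h1 h2 h3
    refine enorm_sum_predictionError_sub_le (hcell k hk) hA_bdd (X ω) h3 h1 ?_ fun i => ?_
    · refine IntegrableOn.of_bound hμA ((measurable_uncurry_mul_restrict hX (hlam_meas θ)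
        (hh_meas θ) hA).comp measurable_prodMk_right).aestronglyMeasurable (H * C)
        (ae_of_all _ fun u => ?_)
      rw [norm_mul, NNReal.norm_eq]
      exact mul_le_mul (enorm_le_coe.1 (hH _ _)) (hC _ _) (NNReal.coe_nonneg _) H.2
    · filter_upwards [h2 i] with u hu huc
      simp [weightedEstimator, hu.1 huc]
  -- A large error forces a doubly occupied cell or a large total integral error.
  calc _ ≤ P ((⋃ i, {ω | 2 ≤ ((X ω).pts ∩ cell k i).ncard}) ∪ {ω | ε ≤ ∑ i, D i ω}) := by
        refine measure_mono_ae ?_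
        filter_upwards [hgood] with ω hω hωε
        by_cases hlt : ∀ i, ((X ω).pts ∩ cell k i).ncard < 2
        · refine Or.inr (le_trans ?_ (hω hlt))
          rw [← edist_zero_right]
          exact hωε
        · push Not at hlt
          exact Or.inl (Set.mem_iUnion.2 hlt)
    _ ≤ (∑ i, P {ω | 2 ≤ ((X ω).pts ∩ cell k i).ncard}) + P {ω | ε ≤ ∑ i, D i ω} :=
        (measure_union_le _ _).trans (by gcongr; exact measure_iUnion_fintype_le _ _)
    _ ≤ (∑ i, (C₀ * μ (cell k i)) ^ 2) + (∑ i, 3 * H * C * C₀ * μ (cell k i) * μ (cell k i)) / ε := by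
        refine add_le_add (Finset.sum_le_sum fun i _ => hX_int.measure_two_le_ncard_le hX hC₀
          ((hcell k hk).measurable i) (hcb k hk i)) ?_
        refine (meas_ge_le_lintegral_div
          (Finset.measurable_fun_sum _ fun i _ => hDm i).aemeasurable hε.ne' hε').trans ?_
        rw [lintegral_finsetSum _ fun i _ => hDm i]
        gcongr with i
        exact (hV k hk i).lintegral_error_le hX hX_int hC₀ (hlam_meas θ) hC (hh_meas θ) hH hA
          ((hcell k hk).measurable i) (hcb k hk i)
    _ = (C₀ ^ 2 + 3 * H * C * C₀ / ε) * ∑ i, μ (cell k i) * μ (cell k i) := by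
        simp only [mul_assoc _ (μ _) (μ _), mul_pow, ← Finset.mul_sum, div_eq_mul_inv, pow_two (μ _)]
        ring
    _ ≤ _ := by
        gcongr
        exact sum_measure_mul_self_le (hcell k hk)
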